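/- Let $n\ge 0$ and equip $\mathbb{R}^{2n+1}$, with coordinates $(x_1,\dots,x_n,y_1,\dots,y_n,z)$, with its standard Sasakian structure $(\phi,\xi,\eta,g)$: $$\eta=dz-\sum_{k=1}^n y_k\,dx_k,\qquad \xi=\frac{\partial}{\partial z},\qquad g=\eta\otimes\eta+\tfrac12\sum_{k=1}^n\big((dx_k)^2+(dy_k)^2\big),$$ $$\phi\frac{\partial}{\partial y_k}=\frac{\partial}{\partial x_k}+y_k\frac{\partial}{\partial z},\qquad \phi\frac{\partial}{\partial x_k}=-\frac{\partial}{\partial y_k},\qquad \phi\frac{\partial}{\partial z}=0,$$ where $d$ is normalized by $2\,d\eta(X,Y)=X(\eta(Y))-Y(\eta(X))-\eta([X,Y])$. Let $L$ be the tangent bundle of a Legendrian foliation $\mathcal F'$ of $(\mathbb{R}^{2n+1},\eta)$, i.e. a smooth, integrable rank-$n$ subbundle of $\ker\eta$ on which $d\eta$ vanishes, and let $Q=\phi L$ be its conjugate distribution. Let $\nabla$ be the bi-Legendrian connection of $(L,Q)$, i.e. the linear connection such that, with $V_L,V_Q$ denoting the components of a vector field $V$ in the splitting $L\oplus Q\oplus\mathbb{R}\xi$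 of the tangent bundle, 1. $\nabla L\subset L$, $\nabla Q\subset Q$ and $\nabla(\mathbb{R}\xi)\subset\mathbb{R}\xi$; 2. $\nabla d\eta=0$; 3. the torsion $T$ of $\nabla$ satisfies $T(X,Y)=2\,d\eta(X,Y)\,\xi$ for all sections $X$ of $L$ and $Y$ of $Q$, and $T(V,\xi)=[\xi,V_L]_Q+[\xi,V_Q]_L$ for all vector fields $V$. Assume that $\mathcal F'$ is flat, i.e. $(\mathcal L_X\mathcal L_{X'}\eta)(\xi)=0$ for all sections $X,X'$ of $L$, that $Q$ is integrable, and that $\nabla g=0$. Then the curvature of $\nabla$ vanishes identically: for all smooth vector fields $U,V,W$ on $\mathbb{R}^{2n+1}$, $$\nabla_U\nabla_VW-\nabla_V\nabla_UW-\nabla_{[U,V]}W=0.$$ -/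

import Mathlib

open scoped Manifold ContDiff Topology
open VectorField

noncomputable section

namespace SasakiR

/-! ### The standard Sasakian structure of `ℝ^{2n+1}` -/

/-- `ℝ^{2n+1}`, with coordinates `x_1, …, x_n, y_1, …, y_n, z` indexed by
`Fin n ⊕ Fin n ⊕ Unit`. -/
abbrev RSpace (n : ℕ) : Type := EuclideanSpace ℝ (Fin n ⊕ Fin n ⊕ Unit)

variable {n : ℕ}

/-- The coordinate `x_k`, as a linear form; it is also the constant `1`-form `dx_k`. -/
def dx (k : Fin n) : RSpace n →L[ℝ] ℝ := EuclideanSpace.proj (Sum.inl k)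

/-- The coordinate `y_k`, as a linear form; it is also the constant `1`-form `dy_k`. -/
def dy (k : Fin n) : RSpace n →L[ℝ] ℝ := EuclideanSpace.proj (Sum.inr (Sum.inl k))

/-- The coordinate `z`, as a linear form; it is also the constant `1`-form `dz`. -/
def dz : RSpace n →L[ℝ] ℝ := EuclideanSpace.proj (Sum.inr (Sum.inr ()))

/-- The coordinate vector `∂/∂x_k`. -/
def ex (k : Fin n) : RSpace n := EuclideanSpace.single (Sum.inl k) 1

/-- The coordinate vector `∂/∂y_k`. -/
def ey (k : Fin n) : RSpace n := EuclideanSpace.single (Sum.inr (Sum.inl k)) 1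

/-- The coordinate vector `∂/∂z`. -/
def ez : RSpace n := EuclideanSpace.single (Sum.inr (Sum.inr ())) 1

/-- The contact form `η = dz - ∑ y_k dx_k`. -/
def eta (p : RSpace n) : RSpace n →L[ℝ] ℝ := dz - ∑ k, dy k p • dx k

/-- The Reeb vector field `ξ = ∂/∂z`. -/
def xi (_p : RSpace n) : RSpace n := ez

/-- The metric `g = η ⊗ η + ½ ∑ (dx_k² + dy_k²)`. -/
def metric (p v w : RSpace n) : ℝ :=
  eta p v * eta p w + 1 / 2 * ∑ k, (dx k v * dx k w + dy k v * dy k w)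

/-- The tensor field `φ`, with matrix `((0, I, 0), (-I, 0, 0), (0, y, 0))`:
it maps `∂/∂y_k` to `∂/∂x_k + y_k ∂/∂z`, `∂/∂x_k` to `-∂/∂y_k` and `∂/∂z` to `0`. -/
def phi (p : RSpace n) : RSpace n →L[ℝ] RSpace n :=
  ∑ k, ((dy k).smulRight (ex k + dy k p • ez) - (dx k).smulRight (ey k))

/-- The exterior derivative of a `1`-form, in the normalization
`2 dα(X, Y) = X(α(Y)) - Y(α(X)) - α([X, Y])`, that is `2 u ∧ v = u ⊗ v - v ⊗ u`. -/
def extD (α : RSpace n → RSpace n →L[ℝ] ℝ) (p v w : RSpace n) : ℝ :=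
  1 / 2 * (fderiv ℝ α p v w - fderiv ℝ α p w v)

/-- The `2`-form `dη`. -/
def dEta (p v w : RSpace n) : ℝ := extD eta p v w

/-! ### Vector fields and distributions -/

/-- Smooth vector fields on `ℝ^{2n+1}`. -/
def IsSmoothField (V : RSpace n → RSpace n) : Prop := ContDiff ℝ ∞ V

/-- `X` is a smooth section of the distribution `L`. -/
def IsSection (L : RSpace n → Submodule ℝ (RSpace n)) (X : RSpace n → RSpace n) : Prop :=
  IsSmoothField X ∧ ∀ p, X p ∈ L p

/-- `L` is a smooth subbundle of rank `r` of the tangent bundle: near every point it has a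
smooth frame with `r` members. -/
def IsSubbundle (r : ℕ) (L : RSpace n → Submodule ℝ (RSpace n)) : Prop :=
  ∀ p, ∃ U : Set (RSpace n), IsOpen U ∧ p ∈ U ∧ ∃ X : Fin r → RSpace n → RSpace n,
    (∀ i, ContDiffOn ℝ ∞ (X i) U) ∧
    ∀ q ∈ U, LinearIndependent ℝ (fun i => X i q) ∧
      Submodule.span ℝ (Set.range fun i => X i q) = L q

/-- Integrability of a distribution: it is closed under the Lie bracket. -/
def IsIntegrable (L : RSpace n → Submodule ℝ (RSpace n)) : Prop :=
  ∀ X Y, IsSection L X → IsSection L Y → IsSection L (lieBracket ℝ X Y)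

/-- Legendrian distributions of `(ℝ^{2n+1}, η)`: subbundles of rank `n` of the contact
distribution `ker η` on which `dη` vanishes. -/
structure IsLegendrianDistribution (L : RSpace n → Submodule ℝ (RSpace n)) : Prop where
  subbundle : IsSubbundle n L
  contact : ∀ p, ∀ v ∈ L p, eta p v = 0
  isotropic : ∀ p, ∀ v ∈ L p, ∀ w ∈ L p, dEta p v w = 0

/-- Legendrian foliations, represented by their tangent bundles: integrable Legendrian
distributions. -/
structure IsLegendrianFoliation (L : RSpace n → Submodule ℝ (RSpace n)) : Prop where
  legendrian : IsLegendrianDistribution L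
  integrable : IsIntegrable L

/-- The Lie derivative of a `1`-form,
`(𝓛_X α)(Y) = X(α(Y)) - α([X, Y]) = (D_X α)(Y) + α(D_Y X)`. -/
def lieDeriv (X : RSpace n → RSpace n) (α : RSpace n → RSpace n →L[ℝ] ℝ) :
    RSpace n → RSpace n →L[ℝ] ℝ :=
  fun p => fderiv ℝ α p (X p) + (α p).comp (fderiv ℝ X p)

/-- The form `Π(X, X') = -(𝓛_X 𝓛_{X'} η)(ξ)` on the sections of a Legendrian foliation. -/
def pangForm (X X' : RSpace n → RSpace n) (p : RSpace n) : ℝ :=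
  -(lieDeriv X (lieDeriv X' eta) p (xi p))

/-- A Legendrian foliation is flat if the form `Π` vanishes identically. -/
def IsFlatFoliation (L : RSpace n → Submodule ℝ (RSpace n)) : Prop :=
  ∀ X X', IsSection L X → IsSection L X' → ∀ p, pangForm X X' p = 0

/-- The conjugate distribution `Q = φ L`. -/
def conjugate (L : RSpace n → Submodule ℝ (RSpace n)) : RSpace n → Submodule ℝ (RSpace n) :=
  fun p => (L p).map (phi p).toLinearMap

/-! ### Linear connections and the bi-Legendrian connection -/

/-- Linear connections on `ℝ^{2n+1}`, that is covariant derivatives on its tangent bundle. -/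
abbrev Connection (n : ℕ) : Type :=
  CovariantDerivative 𝓘(ℝ, RSpace n) (RSpace n)
    (TangentSpace 𝓘(ℝ, RSpace n) : RSpace n → Type)

/-- The vector field `∇_V W`. -/
def nabla (D : Connection n) (V W : RSpace n → RSpace n) : RSpace n → RSpace n :=
  fun p => D W p (V p)

/-- The torsion `T(V, W) = ∇_V W - ∇_W V - [V, W]`. -/
def torsionField (D : Connection n) (V W : RSpace n → RSpace n) : RSpace n → RSpace n :=
  fun p => nabla D V W p - nabla D W V p - lieBracket ℝ V W p

/-- The curvature `R(U, V)W = ∇_U ∇_V W - ∇_V ∇_U W - ∇_{[U, V]} W`. -/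
def curvatureField (D : Connection n) (U V W : RSpace n → RSpace n) : RSpace n → RSpace n :=
  fun p => nabla D U (nabla D V W) p - nabla D V (nabla D U W) p
    - nabla D (lieBracket ℝ U V) W p

/-- `∇ B = 0`, for a field `B` of bilinear forms:
`V(B(W, Z)) = B(∇_V W, Z) + B(W, ∇_V Z)`. -/
def IsParallel (D : Connection n) (B : RSpace n → RSpace n → RSpace n → ℝ) : Prop :=
  ∀ V W Z, IsSmoothField V → IsSmoothField W → IsSmoothField Z → ∀ p,
    fderiv ℝ (fun q => B q (W q) (Z q)) p (V p)
      = B p (nabla D V W p) (Z p) + B p (W p) (nabla D V Z p)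

/-- `∇ L ⊂ L`: covariant derivatives of sections of `L` lie in `L`. -/
def Preserves (D : Connection n) (L : RSpace n → Submodule ℝ (RSpace n)) : Prop :=
  ∀ V X, IsSmoothField V → IsSection L X → ∀ p, nabla D V X p ∈ L p

/-- The line bundle `ℝξ`. -/
def reebLine : RSpace n → Submodule ℝ (RSpace n) := fun p => Submodule.span ℝ {xi p}

open Classical in
/-- The component `V_A` of a vector field `V` in `A`, with respect to the splitting
`A ⊕ B ⊕ ℝξ` of the tangent bundle (and `0` at points where `A`, `B` and `ℝξ` do not split
the tangent space). -/
def component (A B : RSpace n → Submodule ℝ (RSpace n)) (V : RSpace n → RSpace n) :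
    RSpace n → RSpace n :=
  fun p => if h : IsCompl (A p) (B p ⊔ reebLine p) then
    (A p).projection (B p ⊔ reebLine p) h (V p) else 0

/-- `D` is the bi-Legendrian connection of the pair `(L₁, L₂)` of transversal Legendrian
distributions: it preserves `L₁`, `L₂` and `ℝξ`, `dη` is parallel,
`T(X, Y) = 2 dη(X, Y) ξ` for sections `X` of `L₁` and `Y` of `L₂`, and
`T(V, ξ) = [ξ, V_{L₁}]_{L₂} + [ξ, V_{L₂}]_{L₁}` for all `V`. -/
structure IsBiLegendrianConnection (L₁ L₂ : RSpace n → Submodule ℝ (RSpace n))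
    (D : Connection n) : Prop where
  preserves_left : Preserves D L₁
  preserves_right : Preserves D L₂
  preserves_reeb : Preserves D reebLine
  parallel_dEta : IsParallel D dEta
  torsion_mixed : ∀ X Y, IsSection L₁ X → IsSection L₂ Y → ∀ p,
    torsionField D X Y p = (2 * dEta p (X p) (Y p)) • xi p
  torsion_reeb : ∀ V, IsSmoothField V → ∀ p,
    torsionField D V xi p
      = component L₂ L₁ (lieBracket ℝ xi (component L₁ L₂ V)) p
        + component L₁ L₂ (lieBracket ℝ xi (component L₂ L₁ V)) p

end SasakiR

end

/-
The Tanaka-Webster connection `D°`, for which the frame `(∂/∂x_k + y_k ∂/∂z, ∂/∂y_k, ∂/∂z)` is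
parallel, is flat, and `∇ = D°`. Indeed the difference tensor `A = ∇ - D°` is skew for `g`, kills
`ξ` and commutes with `φ`, and the torsion condition on `L × φL` reads `A_{φy} x = φ (A_x y)` for
`x, y ∈ L`. Hence, on `L`, `g(A_x y, z)` is symmetric in `x, z` and skew in `y, z`, while
`g(A_x y, φ z)` is symmetric in `y, z` and skew in `x, z`; both vanish, so `A_v = 0` for
`v ∈ ker η`. Therefore `L` is `D°`-parallel along `ker η`, and, `D°` being flat, also along the
brackets of fields in `ker η`, in particular along `ξ`. So `[ξ, X] = D°_ξ X` lies in `L` for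
sections `X` of `L`, and the remaining torsion condition gives `A_ξ = 0`.
-/

noncomputable section

namespace SasakiR

variable {n : ℕ}

@[simp] lemma dx_ex (j k : Fin n) : dx j (ex k) = if j = k then 1 else 0 := by
  simp [dx, ex]

@[simp] lemma dx_ey (j k : Fin n) : dx j (ey k) = 0 := by
  simp [dx, ey]

@[simp] lemma dx_ez (j : Fin n) : dx j (ez : RSpace n) = 0 := by
  simp [dx, ez]

@[simp] lemma dy_ex (j k : Fin n) : dy j (ex k) = 0 := by
  simp [dy, ex]

@[simp] lemma dy_ey (j k : Fin n) : dy j (ey k) = if j = k then 1 else 0 := by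
  simp [dy, ey]

@[simp] lemma dy_ez (j : Fin n) : dy j (ez : RSpace n) = 0 := by
  simp [dy, ez]

@[simp] lemma dz_ex (k : Fin n) : dz (ex k) = 0 := by
  simp [dz, ex]

@[simp] lemma dz_ey (k : Fin n) : dz (ey k) = 0 := by
  simp [dz, ey]

@[simp] lemma dz_ez : dz (ez : RSpace n) = 1 := by
  simp [dz, ez]

/-- The constant bilinear form `∑ dy_k ⊗ dx_k`, in terms of which `η = dz - β(p, ·)` and
`2 dη(v, w) = β(w, v) - β(v, w)`. -/
def beta : RSpace n →L[ℝ] RSpace n →L[ℝ] ℝ := ∑ k, (dy k).smulRight (dx k)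

lemma beta_apply (v w : RSpace n) : beta v w = ∑ k, dy k v * dx k w := by
  simp [beta]

@[simp] lemma beta_ez_right (v : RSpace n) : beta v ez = 0 := by simp [beta_apply]

lemma eta_eq : (eta : RSpace n → RSpace n →L[ℝ] ℝ) = fun p => dz - beta p := by
  funext p
  ext v
  simp [eta, beta_apply]

lemma eta_apply (p v : RSpace n) : eta p v = dz v - beta p v := by
  simp [eta_eq]

@[simp] lemma eta_xi (p : RSpace n) : eta p (xi p) = 1 := by simp [eta_apply, xi]

lemma dEta_eq (p v w : RSpace n) : dEta p v w = 1 / 2 * (beta w v - beta v w) := by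
  have h : HasFDerivAt eta (-beta : RSpace n →L[ℝ] _) p := by
    rw [eta_eq]
    exact beta.hasFDerivAt.const_sub _
  simp only [dEta, extD, h.fderiv, neg_apply]
  ring

@[simp] lemma dEta_xi (p v : RSpace n) : dEta p v (xi p) = 0 := by
  simp [dEta_eq, beta_apply, xi]

lemma dEta_comm (p v w : RSpace n) : dEta p v w = -dEta p w v := by
  simp only [dEta_eq]
  ring

lemma ext_of_forms (p : RSpace n) {v w : RSpace n} (hx : ∀ k, dx k v = dx k w)
    (hy : ∀ k, dy k v = dy k w) (he : eta p v = eta p w) : v = w := by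
  have hz : dz v = dz w := by
    simp only [eta_apply, beta_apply, hx] at he
    linarith
  ext i
  rcases i with k | k | _
  exacts [hx k, hy k, hz]

/-- The coframe `(dx_k, dy_k, η)` at `p`, as an endomorphism of `ℝ^{2n+1}`. -/
def coframe (p : RSpace n) : RSpace n →L[ℝ] RSpace n :=
  ContinuousLinearMap.id ℝ (RSpace n) - (beta p).smulRight ez

lemma coframe_apply (p v : RSpace n) : coframe p v = v - beta p v • ez := by
  simp [coframe]

lemma contDiff_coframe : ContDiff ℝ ∞ (coframe : RSpace n → RSpace n →L[ℝ] RSpace n) := by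
  unfold coframe
  exact contDiff_const.sub (beta.contDiff.smulRight contDiff_const)

@[simp] lemma dx_coframe (p v : RSpace n) (k : Fin n) : dx k (coframe p v) = dx k v := by
  simp [coframe_apply]

@[simp] lemma dy_coframe (p v : RSpace n) (k : Fin n) : dy k (coframe p v) = dy k v := by
  simp [coframe_apply]

@[simp] lemma dz_coframe (p v : RSpace n) : dz (coframe p v) = eta p v := by
  simp [coframe_apply, eta_apply]

lemma coframe_injective (p : RSpace n) : Function.Injective (coframe p) := fun v w h =>
  ext_of_forms p (fun k => by simpa using congrArg (dx k) h)
    (fun k => by simpa using congrArg (dy k) h) (by simpa using congrArg dz h)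

/-- The bilinear form `dz ⊗ dz + ½ ∑ (dx_k² + dy_k²)`, which represents the metric in the
coframe `(dx_k, dy_k, η)`. -/
def frameMetric : RSpace n →L[ℝ] RSpace n →L[ℝ] ℝ :=
  dz.smulRight dz + (1 / 2 : ℝ) • ∑ k, ((dx k).smulRight (dx k) + (dy k).smulRight (dy k))

lemma metric_eq_coframe :
    (metric : RSpace n → RSpace n → RSpace n → ℝ) =
      fun p v w => frameMetric (coframe p v) (coframe p w) := by
  funext p v w
  simp [metric, frameMetric]

/-- The constant bilinear form which represents `dη` in the coframe `(dx_k, dy_k, η)`. -/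
def frameDEta : RSpace n →L[ℝ] RSpace n →L[ℝ] ℝ := (1 / 2 : ℝ) • (beta.flip - beta)

lemma dEta_eq_coframe :
    (dEta : RSpace n → RSpace n → RSpace n → ℝ) =
      fun p v w => frameDEta (coframe p v) (coframe p w) := by
  funext p v w
  simp [frameDEta, dEta_eq, beta_apply]

lemma metric_comm (p v w : RSpace n) : metric p v w = metric p w v := by
  simp only [metric, mul_comm]

@[simp] lemma metric_xi (p v : RSpace n) : metric p v (xi p) = eta p v := by
  rw [metric, eta_xi]
  simp [xi]

lemma eq_zero_of_metric_self {p v : RSpace n} (h : metric p v v = 0) : v = 0 := by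
  have hterm (k : Fin n) : 0 ≤ dx k v * dx k v + dy k v * dy k v :=
    add_nonneg (mul_self_nonneg _) (mul_self_nonneg _)
  have hsum := Finset.sum_nonneg fun k (_ : k ∈ Finset.univ) => hterm k
  obtain ⟨heta, hsum0⟩ := (add_eq_zero_iff_of_nonneg (mul_self_nonneg (eta p v))
    (mul_nonneg one_half_pos.le hsum)).1 h
  have hzero (k : Fin n) : dx k v = 0 ∧ dy k v = 0 :=
    mul_self_add_mul_self_eq_zero.1
      ((Finset.sum_eq_zero_iff_of_nonneg fun k _ => hterm k).1
        ((mul_eq_zero.1 hsum0).resolve_left (by norm_num)) k (Finset.mem_univ k))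
  exact ext_of_forms p (by simp [hzero]) (by simp [hzero]) (by simp [mul_self_eq_zero.1 heta])

lemma metric_add_right (p u v w : RSpace n) :
    metric p u (v + w) = metric p u v + metric p u w := by
  simp [metric_eq_coframe]

lemma metric_smul_right (p u v : RSpace n) (c : ℝ) :
    metric p u (c • v) = c * metric p u v := by
  simp [metric_eq_coframe]

lemma metric_neg_right (p u v : RSpace n) : metric p u (-v) = -metric p u v := by
  simp [metric_eq_coframe]

lemma metric_zero_right (p u : RSpace n) : metric p u 0 = 0 := by
  simp [metric_eq_coframe]

lemma metric_sub_right (p u v w : RSpace n) :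
    metric p u (v - w) = metric p u v - metric p u w := by
  simp [metric_eq_coframe]

lemma eq_of_metric_eq {p v w : RSpace n} (h : ∀ u, metric p u v = metric p u w) : v = w :=
  sub_eq_zero.1 (eq_zero_of_metric_self (p := p) (by rw [metric_sub_right, h, sub_self]))

lemma phi_eq (p v : RSpace n) :
    phi p v = ∑ k, (dy k v • (ex k + dy k p • ez) - dx k v • ey k) := by
  simp [phi]

@[simp] lemma dx_phi (p v : RSpace n) (j : Fin n) : dx j (phi p v) = dy j v := by
  simp [phi_eq, map_sum]

@[simp] lemma dy_phi (p v : RSpace n) (j : Fin n) : dy j (phi p v) = -dx j v := by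
  simp [phi_eq, map_sum]

@[simp] lemma eta_phi (p v : RSpace n) : eta p (phi p v) = 0 := by
  simp only [eta_apply, beta_apply, dx_phi]
  simp [phi_eq p v, map_sum, mul_comm]

lemma phi_phi {p v : RSpace n} (h : eta p v = 0) : phi p (phi p v) = -v :=
  ext_of_forms p (by simp) (by simp) (by simp [h])

lemma metric_phi (p v w : RSpace n) : metric p v (phi p w) = dEta p v w := by
  simp [metric, dEta_eq, beta_apply, mul_comm, ← sub_eq_add_neg]

lemma metric_phi_phi (p v : RSpace n) {w : RSpace n} (hw : eta p w = 0) :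
    metric p (phi p v) (phi p w) = metric p v w := by
  simp [metric, hw, add_comm]

lemma contDiff_phi : ContDiff ℝ ∞ (phi : RSpace n → RSpace n →L[ℝ] RSpace n) := by
  unfold phi
  refine ContDiff.sum fun k _ => ContDiff.sub ?_ contDiff_const
  exact contDiff_const.smulRight (by fun_prop)

section vectorSpace

variable {𝕜 E : Type*} [NontriviallyNormedField 𝕜] [NormedAddCommGroup E] [NormedSpace 𝕜 E]

lemma mdifferentiableAt_vectorSpace_iff {V : Π x : E, TangentSpace 𝓘(𝕜, E) x} {x : E} :
    MDiffAt (T% V) x ↔ DifferentiableAt 𝕜 (V : E → E) x := by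
  refine ⟨fun h => ?_, fun h => ?_⟩
  · exact (((contMDiff_snd_tangentBundle_modelSpace (n := 1) E 𝓘(𝕜, E)).mdifferentiable
      one_ne_zero _).comp x h).differentiableAt
  · refine (mdifferentiableAt_totalSpace ..).2 ⟨mdifferentiableAt_id, ?_⟩
    convert! h.mdifferentiableAt with y
    simp

lemma mvfderiv_vectorSpace (f : E → 𝕜) (x : E) : mvfderiv 𝓘(𝕜, E) f x = fderiv 𝕜 f x := by
  rw [mvfderiv, mfderiv_eq_fderiv]
  rfl

end vectorSpace

/-- The covariant derivative `v ↦ D°_v W` of the Tanaka-Webster connection `D°`: the components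
of `W` in the coframe `(dx_k, dy_k, η)` are differentiated. The term in `β` accounts for the
derivative of the coframe. -/
def tanakaWebsterDeriv (W : RSpace n → RSpace n) (p : RSpace n) : RSpace n →L[ℝ] RSpace n :=
  fderiv ℝ W p - (beta.flip (W p)).smulRight ez

lemma tanakaWebsterDeriv_apply (W : RSpace n → RSpace n) (p v : RSpace n) :
    tanakaWebsterDeriv W p v = fderiv ℝ W p v - beta v (W p) • ez := by
  simp [tanakaWebsterDeriv]

lemma tanakaWebsterDeriv_add {W Z : RSpace n → RSpace n} {p : RSpace n}
    (hW : DifferentiableAt ℝ W p) (hZ : DifferentiableAt ℝ Z p) :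
    tanakaWebsterDeriv (W + Z) p = tanakaWebsterDeriv W p + tanakaWebsterDeriv Z p := by
  ext1 v
  simp only [tanakaWebsterDeriv_apply, fderiv_add hW hZ, add_apply, Pi.add_apply, map_add]
  module

lemma tanakaWebsterDeriv_smul {f : RSpace n → ℝ} {W : RSpace n → RSpace n} {p : RSpace n}
    (hf : DifferentiableAt ℝ f p) (hW : DifferentiableAt ℝ W p) :
    tanakaWebsterDeriv (f • W) p =
      f p • tanakaWebsterDeriv W p + (fderiv ℝ f p).smulRight (W p) := by
  ext1 v
  simp only [tanakaWebsterDeriv_apply, fderiv_smul hf hW, add_apply, smul_apply, Pi.smul_apply',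
    ContinuousLinearMap.smulRight_apply, map_smul, smul_eq_mul]
  module

/-- The Tanaka-Webster connection `D°` of `ℝ^{2n+1}`, for which the frame
`(∂/∂x_k + y_k ∂/∂z, ∂/∂y_k, ∂/∂z)` is parallel. -/
def tanakaWebster (n : ℕ) : Connection n where
  toFun := tanakaWebsterDeriv
  isCovariantDerivativeOnUniv :=
    { add := fun hW hZ _ => tanakaWebsterDeriv_add
        (mdifferentiableAt_vectorSpace_iff.1 hW) (mdifferentiableAt_vectorSpace_iff.1 hZ)
      leibniz := fun {W f p} hW hf _ => by
        rw [mvfderiv_vectorSpace]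
        exact tanakaWebsterDeriv_smul hf.differentiableAt
          (mdifferentiableAt_vectorSpace_iff.1 hW) }

lemma nabla_tanakaWebster (V W : RSpace n → RSpace n) (p : RSpace n) :
    nabla (tanakaWebster n) V W p = fderiv ℝ W p (V p) - beta (V p) (W p) • ez :=
  tanakaWebsterDeriv_apply W p (V p)

lemma fderiv_xi (p : RSpace n) : fderiv ℝ xi p = 0 := fderiv_const_apply ez

lemma IsSmoothField.differentiable {V : RSpace n → RSpace n} (hV : IsSmoothField V) :
    Differentiable ℝ V :=
  ContDiff.differentiable hV (by simp)

lemma IsSmoothField.nabla_tanakaWebster {V W : RSpace n → RSpace n} (hV : IsSmoothField V)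
    (hW : IsSmoothField W) : IsSmoothField (nabla (tanakaWebster n) V W) :=
  ((ContDiff.fderiv_right hW (by simp)).clm_apply hV).sub
    (((beta.contDiff.comp hV).clm_apply hW).smul contDiff_const)

lemma hasFDerivAt_coframe {W : RSpace n → RSpace n} {p : RSpace n}
    (hW : DifferentiableAt ℝ W p) :
    HasFDerivAt (fun q => coframe q (W q)) ((coframe p).comp (tanakaWebsterDeriv W p)) p := by
  have hbeta : HasFDerivAt (fun q => beta q (W q)) _ p :=
    beta.hasFDerivAt_of_bilinear (hasFDerivAt_id p) hW.hasFDerivAt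
  simp only [coframe_apply]
  refine (hW.hasFDerivAt.sub (hbeta.smul_const ez)).congr_fderiv ?_
  ext1 v
  simp only [ContinuousLinearMap.precompR_apply, ContinuousLinearMap.compL_apply, sub_apply,
    ContinuousLinearMap.smulRight_apply, add_apply, ContinuousLinearMap.comp_apply,
    ContinuousLinearMap.precompL_apply, ContinuousLinearMap.id_apply, tanakaWebsterDeriv_apply,
    coframe_apply, map_sub, map_smul, beta_ez_right]
  module

lemma isParallel_tanakaWebster (B : RSpace n →L[ℝ] RSpace n →L[ℝ] ℝ) :
    IsParallel (tanakaWebster n) fun p v w => B (coframe p v) (coframe p w) := by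
  intro V W Z _ hW hZ p
  have h := B.hasFDerivAt_of_bilinear (hasFDerivAt_coframe (hW.differentiable p))
    (hasFDerivAt_coframe (hZ.differentiable p))
  rw [h.fderiv]
  exact add_comm _ _

lemma torsionField_tanakaWebster (V W : RSpace n → RSpace n) (p : RSpace n) :
    torsionField (tanakaWebster n) V W p = (2 * dEta p (V p) (W p)) • xi p := by
  simp only [torsionField, nabla_tanakaWebster, lieBracket, dEta_eq, xi]
  module

lemma eta_tanakaWebsterDeriv {W : RSpace n → RSpace n} {p : RSpace n}
    (hW : DifferentiableAt ℝ W p) (hηW : ∀ q, eta q (W q) = 0) (v : RSpace n) :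
    eta p (tanakaWebsterDeriv W p v) = 0 := by
  have hderiv := dz.hasFDerivAt.comp p (hasFDerivAt_coframe hW)
  have hconst : (dz : RSpace n → ℝ) ∘ (fun q => coframe q (W q)) = fun _ => 0 := by
    funext q
    simp [hηW]
  rw [hconst] at hderiv
  rw [← dz_coframe]
  exact DFunLike.congr_fun (hderiv.unique (hasFDerivAt_const 0 p)) v

lemma eta_lieBracket {X Y : RSpace n → RSpace n} (hX : IsSmoothField X) (hY : IsSmoothField Y)
    (hηX : ∀ q, eta q (X q) = 0) (hηY : ∀ q, eta q (Y q) = 0) (p : RSpace n) :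
    eta p (lieBracket ℝ X Y p) = -(2 * dEta p (X p) (Y p)) := by
  have h := congrArg (eta p) (torsionField_tanakaWebster X Y p)
  have hXY : eta p (nabla (tanakaWebster n) X Y p) = 0 :=
    eta_tanakaWebsterDeriv (hY.differentiable p) hηY (X p)
  have hYX : eta p (nabla (tanakaWebster n) Y X p) = 0 :=
    eta_tanakaWebsterDeriv (hX.differentiable p) hηX (Y p)
  rw [torsionField, map_sub, map_sub, hXY, hYX, map_smul, eta_xi, smul_eq_mul, mul_one] at h
  linarith

theorem curvatureField_tanakaWebster {U V W : RSpace n → RSpace n} (hU : IsSmoothField U)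
    (hV : IsSmoothField V) (hW : IsSmoothField W) (p : RSpace n) :
    curvatureField (tanakaWebster n) U V W p = 0 := by
  apply coframe_injective p
  have hcov {X Y : RSpace n → RSpace n} (hY : IsSmoothField Y) (q : RSpace n) :
      coframe q (nabla (tanakaWebster n) X Y q) = fderiv ℝ (fun q => coframe q (Y q)) q (X q) :=
    DFunLike.congr_fun (hasFDerivAt_coframe (hY.differentiable q)).fderiv.symm (X q)
  have hsmooth : ContDiff ℝ ∞ fun q => coframe q (W q) :=
    contDiff_coframe.clm_apply hW
  simp only [curvatureField, map_sub, hcov hW, hcov (hU.nabla_tanakaWebster hW),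
    hcov (hV.nabla_tanakaWebster hW), map_zero]
  rw [fderiv_apply_lieBracket hsmooth.contDiffAt (by simp; norm_cast) (hV.differentiable p)
    (hU.differentiable p), sub_self]

/-- The difference tensor `A_v w = ∇_v w - D°_v w` of a connection `∇` and the Tanaka-Webster
connection `D°`. -/
def diffTensor (D : Connection n) (p : RSpace n) : RSpace n →L[ℝ] RSpace n →L[ℝ] RSpace n :=
  (D.difference (tanakaWebster n) p).flip

lemma nabla_eq_add_diffTensor (D : Connection n) (V : RSpace n → RSpace n)
    {W : RSpace n → RSpace n} {p : RSpace n} (hW : DifferentiableAt ℝ W p) :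
    nabla D V W p = nabla (tanakaWebster n) V W p + diffTensor D p (V p) (W p) := by
  have h := IsCovariantDerivativeOn.difference_apply D.isCovariantDerivativeOnUniv
    (tanakaWebster n).isCovariantDerivativeOnUniv (Set.mem_univ p)
    (mdifferentiableAt_vectorSpace_iff.2 hW)
  exact sub_eq_iff_eq_add'.1 (DFunLike.congr_fun h.symm (V p))

lemma isSmoothField_const (v : RSpace n) : IsSmoothField fun _ => v := contDiff_const

lemma isSmoothField_xi : IsSmoothField (xi : RSpace n → RSpace n) := contDiff_const

lemma torsionField_eq (D : Connection n) {V W : RSpace n → RSpace n} (hV : IsSmoothField V)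
    (hW : IsSmoothField W) (p : RSpace n) :
    torsionField D V W p = diffTensor D p (V p) (W p) - diffTensor D p (W p) (V p)
      + (2 * dEta p (V p) (W p)) • xi p := by
  rw [← torsionField_tanakaWebster V W p, torsionField, torsionField,
    nabla_eq_add_diffTensor D V (hW.differentiable p),
    nabla_eq_add_diffTensor D W (hV.differentiable p)]
  module

lemma IsParallel.diffTensor_skew {D : Connection n} {B : RSpace n →L[ℝ] RSpace n →L[ℝ] ℝ}
    (hB : IsParallel D fun p v w => B (coframe p v) (coframe p w)) (p u v w : RSpace n) :
    B (coframe p (diffTensor D p u v)) (coframe p w) +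
      B (coframe p v) (coframe p (diffTensor D p u w)) = 0 := by
  have hconst (a : RSpace n) : DifferentiableAt ℝ (fun _ : RSpace n => a) p :=
    differentiableAt_const a
  have h := hB _ _ _ (isSmoothField_const u) (isSmoothField_const v) (isSmoothField_const w) p
  have h0 := isParallel_tanakaWebster B _ _ _ (isSmoothField_const u) (isSmoothField_const v)
    (isSmoothField_const w) p
  simp only [nabla_eq_add_diffTensor D _ (hconst _), map_add, add_apply] at h
  linarith

lemma IsParallel.metric_diffTensor {D : Connection n} (hg : IsParallel D metric)
    (p u v w : RSpace n) :
    metric p (diffTensor D p u v) w = -metric p v (diffTensor D p u w) := by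
  rw [metric_eq_coframe] at hg ⊢
  exact eq_neg_of_add_eq_zero_left (hg.diffTensor_skew p u v w)

lemma IsParallel.dEta_diffTensor {D : Connection n} (hη : IsParallel D dEta)
    (p u v w : RSpace n) :
    dEta p (diffTensor D p u v) w = -dEta p v (diffTensor D p u w) := by
  rw [dEta_eq_coframe] at hη ⊢
  exact eq_neg_of_add_eq_zero_left (hη.diffTensor_skew p u v w)

lemma diffTensor_phi {D : Connection n} (hg : IsParallel D metric) (hη : IsParallel D dEta)
    (p u v : RSpace n) : diffTensor D p u (phi p v) = phi p (diffTensor D p u v) := by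
  refine eq_of_metric_eq (p := p) fun w => ?_
  rw [← neg_inj, ← hg.metric_diffTensor, metric_phi, metric_phi, hη.dEta_diffTensor]

lemma diffTensor_xi {D : Connection n} (hg : IsParallel D metric)
    (hξ : Preserves D reebLine) (p v : RSpace n) : diffTensor D p v (xi p) = 0 := by
  have hmem := hξ (fun _ => v) xi (isSmoothField_const v)
    ⟨isSmoothField_xi, fun q => Submodule.mem_span_singleton_self _⟩ p
  have hpar : nabla (tanakaWebster n) (fun _ => v) xi p = 0 := by
    simp [nabla_tanakaWebster, fderiv_xi, xi]
  rw [nabla_eq_add_diffTensor D _ (isSmoothField_xi.differentiable p), hpar, zero_add] at hmem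
  obtain ⟨c, hc⟩ := Submodule.mem_span_singleton.1 hmem
  have hskew := hg.metric_diffTensor p v (xi p) (xi p)
  rw [metric_comm p (xi p), metric_xi, ← hc, map_smul, eta_xi] at hskew
  rw [← hc, show c = 0 by simpa [self_eq_neg] using hskew, zero_smul]

lemma eq_zero_of_symm_of_skew {ι G : Type*} [AddCommGroup G] [IsAddTorsionFree G]
    {T : ι → ι → ι → G} (hsymm : ∀ x y z, T x y z = T z y x)
    (hskew : ∀ x y z, T x y z = -T x z y) (x y z : ι) : T x y z = 0 :=
  self_eq_neg.1 <| calc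
    T x y z = -T z x y := by rw [hsymm, hskew]
    _ = T y z x := by rw [hsymm, hskew, neg_neg]
    _ = -T x y z := by rw [hsymm, hskew]

lemma IsSubbundle.exists_section {r : ℕ} {L : RSpace n → Submodule ℝ (RSpace n)}
    (hL : IsSubbundle r L) {p x : RSpace n} (hx : x ∈ L p) : ∃ X, IsSection L X ∧ X p = x := by
  obtain ⟨U, hU, hpU, X, hX, hspan⟩ := hL p
  obtain ⟨f, hf, -, hfs, -, hfp⟩ := exists_contDiff_tsupport_subset (n := (⊤ : ℕ∞))
    (hU.mem_nhds hpU)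
  rw [← (hspan p hpU).2] at hx
  obtain ⟨c, rfl⟩ := (Submodule.mem_span_range_iff_exists_fun ℝ).1 hx
  refine ⟨fun q => f q • ∑ i, c i • X i q, ⟨?_, ?_⟩, by simp [hfp]⟩
  · refine contDiff_iff_contDiffAt.2 fun q => ?_
    by_cases hq : q ∈ tsupport f
    · have hq' : U ∈ 𝓝 q := hU.mem_nhds (hf hq)
      exact hfs.contDiffAt.smul
        (ContDiffAt.sum fun i _ => ((hX i).contDiffAt hq').const_smul (c i))
    · refine (contDiffAt_const (c := (0 : RSpace n))).congr_of_eventuallyEq ?_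
      filter_upwards [notMem_tsupport_iff_eventuallyEq.1 hq] with y hy
      simp [hy]
  · intro q
    by_cases hq : q ∈ tsupport f
    · rw [← (hspan q (hf hq)).2]
      exact Submodule.smul_mem _ _ (Submodule.sum_mem _ fun i _ =>
        Submodule.smul_mem _ _ (Submodule.subset_span ⟨i, rfl⟩))
    · simp [image_eq_zero_of_notMem_tsupport hq]

lemma IsSubbundle.finrank_eq {r : ℕ} {L : RSpace n → Submodule ℝ (RSpace n)}
    (hL : IsSubbundle r L) (p : RSpace n) : Module.finrank ℝ (L p) = r := by
  obtain ⟨U, -, hpU, X, -, hX⟩ := hL p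
  rw [← (hX p hpU).2, finrank_span_eq_card (hX p hpU).1, Fintype.card_fin]

lemma IsSection.phi {L : RSpace n → Submodule ℝ (RSpace n)} {X : RSpace n → RSpace n}
    (hX : IsSection L X) : IsSection (conjugate L) fun p => phi p (X p) :=
  ⟨contDiff_phi.clm_apply hX.1, fun p => ⟨X p, hX.2 p, rfl⟩⟩

section component

variable {A B : RSpace n → Submodule ℝ (RSpace n)} {V : RSpace n → RSpace n} {p : RSpace n}

lemma component_of_mem_left (h : IsCompl (A p) (B p ⊔ reebLine p)) (hV : V p ∈ A p) :
    component A B V p = V p := by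
  rw [component, dif_pos h]
  exact Submodule.projection_apply_left h ⟨V p, hV⟩

lemma component_of_mem_right (hV : V p ∈ B p) : component A B V p = 0 := by
  rw [component]
  split_ifs with h
  · exact (Submodule.projection_apply_eq_zero_iff h).2 (Submodule.mem_sup_left hV)
  · rfl

end component

lemma disjoint_conjugate_reebLine (L : RSpace n → Submodule ℝ (RSpace n)) (p : RSpace n) :
    Disjoint (conjugate L p) (reebLine p) := by
  rw [Submodule.disjoint_def]
  rintro _ ⟨v, -, rfl⟩ hmem
  obtain ⟨c, hc⟩ := Submodule.mem_span_singleton.1 hmem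
  have hη := congrArg (eta p) hc
  rw [map_smul, eta_xi] at hη
  rw [← hc, show c = 0 by simpa using hη, zero_smul]

namespace IsLegendrianDistribution

variable {L : RSpace n → Submodule ℝ (RSpace n)}

lemma finrank_conjugate (hL : IsLegendrianDistribution L) (p : RSpace n) :
    Module.finrank ℝ (conjugate L p) = n := by
  have hinj : Function.Injective ((phi p).toLinearMap.domRestrict (L p)) := by
    rw [injective_iff_map_eq_zero]
    rintro ⟨v, hv⟩ (hφv : phi p v = 0)
    have hφφv := phi_phi (hL.contact p v hv)
    rw [hφv, map_zero] at hφφv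
    exact Subtype.ext (neg_eq_zero.1 hφφv.symm)
  have hrange := LinearMap.finrank_range_of_inj hinj
  rw [LinearMap.range_domRestrict] at hrange
  exact hrange.trans (hL.subbundle.finrank_eq p)

lemma disjoint_sup (hL : IsLegendrianDistribution L) (p : RSpace n) :
    Disjoint (L p) (conjugate L p ⊔ reebLine p) := by
  rw [Submodule.disjoint_def]
  intro v hv hmem
  obtain ⟨_, ⟨y, hy, rfl⟩, _, hξ, hsum⟩ := Submodule.mem_sup.1 hmem
  obtain ⟨c, rfl⟩ := Submodule.mem_span_singleton.1 hξ
  refine eq_zero_of_metric_self (p := p) ?_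
  calc metric p v v = metric p v (phi p y + c • xi p) := by rw [← hsum]; rfl
    _ = 0 := by
      rw [metric_add_right, metric_smul_right, metric_phi, metric_xi, hL.isotropic p v hv y hy,
        hL.contact p v hv, mul_zero, add_zero]

lemma isCompl (hL : IsLegendrianDistribution L) (p : RSpace n) :
    IsCompl (L p) (conjugate L p ⊔ reebLine p) := by
  refine (Submodule.isCompl_iff_disjoint _ _ ?_).2 (hL.disjoint_sup p)
  have hreeb : Module.finrank ℝ (reebLine p) = 1 := by
    refine finrank_span_singleton fun h => ?_
    simpa using congrArg (eta p) h
  have hsum := Submodule.finrank_sup_add_finrank_inf_eq (conjugate L p) (reebLine p)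
  rw [(disjoint_conjugate_reebLine L p).eq_bot, finrank_bot, hL.finrank_conjugate, hreeb] at hsum
  rw [hL.subbundle.finrank_eq p, finrank_euclideanSpace]
  simp only [Fintype.card_sum, Fintype.card_fin, Fintype.card_unit]
  omega

lemma exists_eq_add_phi_add_xi (hL : IsLegendrianDistribution L) (p v : RSpace n) :
    ∃ x ∈ L p, ∃ y ∈ L p, ∃ c : ℝ, v = x + phi p y + c • xi p := by
  have hv : v ∈ L p ⊔ (conjugate L p ⊔ reebLine p) := by
    rw [(hL.isCompl p).sup_eq_top]
    trivial
  obtain ⟨x, hx, _, hyξ, rfl⟩ := Submodule.mem_sup.1 hv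
  obtain ⟨_, ⟨y, hy, rfl⟩, _, hξ, rfl⟩ := Submodule.mem_sup.1 hyξ
  obtain ⟨c, rfl⟩ := Submodule.mem_span_singleton.1 hξ
  exact ⟨x, hx, y, hy, c, (add_assoc _ _ _).symm⟩

lemma eq_zero_of_metric_eq_zero (hL : IsLegendrianDistribution L) {p v : RSpace n}
    (hx : ∀ x ∈ L p, metric p v x = 0) (hφx : ∀ x ∈ L p, metric p v (phi p x) = 0)
    (hξ : eta p v = 0) : v = 0 := by
  obtain ⟨x, hxL, y, hyL, c, hv⟩ := hL.exists_eq_add_phi_add_xi p v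
  refine eq_zero_of_metric_self (p := p) ?_
  calc metric p v v = metric p v (x + phi p y + c • xi p) := by rw [← hv]
    _ = 0 := by
      rw [metric_add_right, metric_add_right, metric_smul_right, metric_xi, hx x hxL, hφx y hyL,
        hξ, mul_zero, add_zero, add_zero]

end IsLegendrianDistribution

namespace IsBiLegendrianConnection

variable {L : RSpace n → Submodule ℝ (RSpace n)} {D : Connection n} {p x y : RSpace n}

lemma diffTensor_mixed (hD : IsBiLegendrianConnection L (conjugate L) D)
    (hL : IsLegendrianDistribution L) (hx : x ∈ L p) (hy : y ∈ L p) :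
    diffTensor D p (phi p y) x = diffTensor D p x (phi p y) := by
  obtain ⟨X, hX, rfl⟩ := hL.subbundle.exists_section hx
  obtain ⟨Y, hY, rfl⟩ := hL.subbundle.exists_section hy
  have h := hD.torsion_mixed X _ hX hY.phi p
  rw [torsionField_eq D hX.1 hY.phi.1] at h
  exact (sub_eq_zero.1 (add_eq_right.1 h)).symm

lemma diffTensor_phi_left (hD : IsBiLegendrianConnection L (conjugate L) D)
    (hL : IsLegendrianDistribution L) (hg : IsParallel D metric) (hx : x ∈ L p) (hy : y ∈ L p) :
    diffTensor D p (phi p y) x = phi p (diffTensor D p x y) := by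
  rw [hD.diffTensor_mixed hL hx hy, diffTensor_phi hg hD.parallel_dEta]

lemma eta_diffTensor (hD : IsBiLegendrianConnection L (conjugate L) D)
    (hg : IsParallel D metric) (u v : RSpace n) : eta p (diffTensor D p u v) = 0 := by
  rw [← metric_xi, hg.metric_diffTensor, diffTensor_xi hg hD.preserves_reeb,
    metric_zero_right, neg_zero]

lemma metric_diffTensor_eq_zero (hD : IsBiLegendrianConnection L (conjugate L) D)
    (hL : IsLegendrianDistribution L) (hg : IsParallel D metric) {z : RSpace n}
    (hx : x ∈ L p) (hy : y ∈ L p) (hz : z ∈ L p) : metric p (diffTensor D p x y) z = 0 := by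
  refine eq_zero_of_symm_of_skew (ι := L p)
    (T := fun x y z => metric p (diffTensor D p x y) z) ?_ ?_ ⟨x, hx⟩ ⟨y, hy⟩ ⟨z, hz⟩
  · rintro ⟨x, hx⟩ ⟨y, hy⟩ ⟨z, hz⟩
    calc metric p (diffTensor D p x y) z
        = metric p (phi p (diffTensor D p x y)) (phi p z) :=
          (metric_phi_phi p _ (hL.contact p z hz)).symm
      _ = metric p (diffTensor D p (phi p y) x) (phi p z) := by
          rw [hD.diffTensor_phi_left hL hg hx hy]
      _ = -metric p x (phi p (phi p (diffTensor D p z y))) := by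
          rw [hg.metric_diffTensor, diffTensor_phi hg hD.parallel_dEta,
            hD.diffTensor_phi_left hL hg hz hy]
      _ = metric p (diffTensor D p z y) x := by
          rw [phi_phi (hD.eta_diffTensor hg z y), metric_neg_right, neg_neg, metric_comm]
  · intro x y z
    rw [hg.metric_diffTensor, metric_comm]

lemma metric_diffTensor_phi_eq_zero (hD : IsBiLegendrianConnection L (conjugate L) D)
    (hL : IsLegendrianDistribution L) (hg : IsParallel D metric) {z : RSpace n}
    (hx : x ∈ L p) (hy : y ∈ L p) (hz : z ∈ L p) :
    metric p (diffTensor D p x y) (phi p z) = 0 := by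
  refine eq_zero_of_symm_of_skew (ι := L p)
    (T := fun y x z => metric p (diffTensor D p x y) (phi p z)) ?_ ?_ ⟨y, hy⟩ ⟨x, hx⟩ ⟨z, hz⟩
  · intro y x z
    rw [hg.metric_diffTensor, diffTensor_phi hg hD.parallel_dEta, metric_phi, metric_phi,
      dEta_comm, neg_neg]
  · rintro ⟨y, hy⟩ ⟨x, hx⟩ ⟨z, hz⟩
    have hrot {u v w : RSpace n} : metric p (diffTensor D p u v) (phi p w)
        = -metric p w (phi p (diffTensor D p u v)) := by
      rw [metric_phi, metric_phi, dEta_comm]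
    calc metric p (diffTensor D p x y) (phi p z)
        = -metric p z (diffTensor D p (phi p y) x) := by
          rw [hrot, hD.diffTensor_phi_left hL hg hx hy]
      _ = metric p x (diffTensor D p (phi p y) z) := by
          rw [metric_comm, hg.metric_diffTensor, neg_neg]
      _ = -metric p (diffTensor D p z y) (phi p x) := by
          rw [hrot, neg_neg, hD.diffTensor_phi_left hL hg hz hy]

lemma diffTensor_left_left (hD : IsBiLegendrianConnection L (conjugate L) D)
    (hL : IsLegendrianDistribution L) (hg : IsParallel D metric) (hx : x ∈ L p) (hy : y ∈ L p) :
    diffTensor D p x y = 0 :=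
  hL.eq_zero_of_metric_eq_zero (fun _ hz => hD.metric_diffTensor_eq_zero hL hg hx hy hz)
    (fun _ hz => hD.metric_diffTensor_phi_eq_zero hL hg hx hy hz) (hD.eta_diffTensor hg x y)

lemma diffTensor_apply_eq_zero (hD : IsBiLegendrianConnection L (conjugate L) D)
    (hL : IsLegendrianDistribution L) (hg : IsParallel D metric) {u : RSpace n}
    (hu : ∀ x ∈ L p, diffTensor D p u x = 0) : diffTensor D p u = 0 := by
  ext1 v
  obtain ⟨x, hx, y, hy, c, rfl⟩ := hL.exists_eq_add_phi_add_xi p v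
  simp [hu x hx, diffTensor_phi hg hD.parallel_dEta, hu y hy, diffTensor_xi hg hD.preserves_reeb]

lemma diffTensor_eq_zero_of_eta_eq_zero (hD : IsBiLegendrianConnection L (conjugate L) D)
    (hL : IsLegendrianDistribution L) (hg : IsParallel D metric) {u : RSpace n}
    (hu : eta p u = 0) : diffTensor D p u = 0 := by
  obtain ⟨x, hx, y, hy, c, rfl⟩ := hL.exists_eq_add_phi_add_xi p u
  have hc : c = 0 := by simpa [hL.contact p x hx] using hu
  refine hD.diffTensor_apply_eq_zero hL hg fun z hz => ?_
  rw [hc, zero_smul, add_zero, map_add, add_apply, hD.diffTensor_left_left hL hg hx hz,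
    hD.diffTensor_phi_left hL hg hz hy, hD.diffTensor_left_left hL hg hz hy, map_zero,
    add_zero]

lemma tanakaWebsterDeriv_mem_of_eta_eq_zero (hD : IsBiLegendrianConnection L (conjugate L) D)
    (hL : IsLegendrianDistribution L) (hg : IsParallel D metric) {X : RSpace n → RSpace n}
    (hX : IsSection L X) {v : RSpace n} (hv : eta p v = 0) : tanakaWebsterDeriv X p v ∈ L p := by
  have hmem := hD.preserves_left (fun _ => v) X (isSmoothField_const v) hX p
  rwa [nabla_eq_add_diffTensor D _ (hX.1.differentiable p),
    hD.diffTensor_eq_zero_of_eta_eq_zero hL hg hv, zero_apply, add_zero] at hmem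

/- By flatness of `D°`, being parallel along `ker η` passes to the bracket `[X, φX]`, which is
transversal to `ker η` because `η([X, φX]) = 2 g(X, X)`. -/
lemma tanakaWebsterDeriv_mem (hD : IsBiLegendrianConnection L (conjugate L) D)
    (hL : IsLegendrianDistribution L) (hg : IsParallel D metric) {X : RSpace n → RSpace n}
    (hX : IsSection L X) (hXp : X p ≠ 0) (v : RSpace n) : tanakaWebsterDeriv X p v ∈ L p := by
  set Y : RSpace n → RSpace n := fun q => phi q (X q)
  have hY : IsSmoothField Y := hX.phi.1
  have hηX (q : RSpace n) : eta q (X q) = 0 := hL.contact q _ (hX.2 q)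
  have hηY (q : RSpace n) : eta q (Y q) = 0 := eta_phi q (X q)
  have hsection {V : RSpace n → RSpace n} (hV : IsSmoothField V) (hηV : ∀ q, eta q (V q) = 0) :
      IsSection L (nabla (tanakaWebster n) V X) :=
    ⟨hV.nabla_tanakaWebster hX.1,
      fun q => hD.tanakaWebsterDeriv_mem_of_eta_eq_zero hL hg hX (hηV q)⟩
  have hbracket : tanakaWebsterDeriv X p (lieBracket ℝ X Y p) ∈ L p := by
    have hflat : nabla (tanakaWebster n) X (nabla (tanakaWebster n) Y X) p
        - nabla (tanakaWebster n) Y (nabla (tanakaWebster n) X X) p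
        = tanakaWebsterDeriv X p (lieBracket ℝ X Y p) :=
      sub_eq_zero.1 (curvatureField_tanakaWebster hX.1 hY hX.1 p)
    rw [← hflat]
    exact (L p).sub_mem
      (hD.tanakaWebsterDeriv_mem_of_eta_eq_zero hL hg (hsection hY hηY) (hηX p))
      (hD.tanakaWebsterDeriv_mem_of_eta_eq_zero hL hg (hsection hX.1 hηX) (hηY p))
  have hη : eta p (lieBracket ℝ X Y p) ≠ 0 := by
    rw [eta_lieBracket hX.1 hY hηX hηY, dEta_comm, ← metric_phi, metric_phi_phi p _ (hηX p)]
    simpa using fun h => hXp (eq_zero_of_metric_self h)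
  set c := eta p v / eta p (lieBracket ℝ X Y p) with hc
  have hsplit : v = (v - c • lieBracket ℝ X Y p) + c • lieBracket ℝ X Y p := by abel
  rw [hsplit, map_add, map_smul]
  refine (L p).add_mem (hD.tanakaWebsterDeriv_mem_of_eta_eq_zero hL hg hX ?_)
    ((L p).smul_mem c hbracket)
  rw [map_sub, map_smul, smul_eq_mul, hc, div_mul_cancel₀ _ hη, sub_self]

lemma torsionField_section_xi (hD : IsBiLegendrianConnection L (conjugate L) D)
    (hL : IsLegendrianDistribution L) {X : RSpace n → RSpace n} (hX : IsSection L X)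
    (hξX : lieBracket ℝ xi X p ∈ L p) : torsionField D X xi p = 0 := by
  have hleft : component L (conjugate L) X = X :=
    funext fun q => component_of_mem_left (hL.isCompl q) (hX.2 q)
  have hright : component (conjugate L) L X = 0 :=
    funext fun q => component_of_mem_right (hX.2 q)
  rw [hD.torsion_reeb X hX.1, hleft, hright, component_of_mem_right hξX, lieBracket_zero_right,
    component_of_mem_right (zero_mem _), add_zero]

lemma diffTensor_xi_left (hD : IsBiLegendrianConnection L (conjugate L) D)
    (hL : IsLegendrianDistribution L) (hg : IsParallel D metric) (hx : x ∈ L p) :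
    diffTensor D p (xi p) x = 0 := by
  rcases eq_or_ne x 0 with rfl | hx0
  · exact map_zero _
  obtain ⟨X, hX, rfl⟩ := hL.subbundle.exists_section hx
  have hbracket : lieBracket ℝ xi X p = tanakaWebsterDeriv X p (xi p) := by
    simp [tanakaWebsterDeriv_apply, lieBracket, fderiv_xi, beta_apply, xi]
  have htorsion := hD.torsionField_section_xi hL hX (p := p)
    (hbracket ▸ hD.tanakaWebsterDeriv_mem hL hg hX hx0 (xi p))
  rw [torsionField_eq D hX.1 isSmoothField_xi, diffTensor_xi hg hD.preserves_reeb,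
    dEta_xi] at htorsion
  simpa using htorsion

theorem diffTensor_eq_zero (hD : IsBiLegendrianConnection L (conjugate L) D)
    (hL : IsLegendrianDistribution L) (hg : IsParallel D metric) (p : RSpace n) :
    diffTensor D p = 0 := by
  ext1 v
  refine hD.diffTensor_apply_eq_zero hL hg fun x hx => ?_
  have hcontact : eta p (v - eta p v • xi p) = 0 := by simp
  have hdiff := DFunLike.congr_fun (hD.diffTensor_eq_zero_of_eta_eq_zero hL hg hcontact) x
  rwa [map_sub, sub_apply, map_smul, smul_apply, hD.diffTensor_xi_left hL hg hx, smul_zero,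
    sub_zero] at hdiff

theorem nabla_eq_tanakaWebster (hD : IsBiLegendrianConnection L (conjugate L) D)
    (hL : IsLegendrianDistribution L) (hg : IsParallel D metric) (V : RSpace n → RSpace n)
    {W : RSpace n → RSpace n} (hW : IsSmoothField W) :
    nabla D V W = nabla (tanakaWebster n) V W := by
  funext p
  rw [nabla_eq_add_diffTensor D V (hW.differentiable p), hD.diffTensor_eq_zero hL hg, zero_apply,
    zero_apply, add_zero]

end IsBiLegendrianConnection

end SasakiR

end

theorem corollary5p1_general (n : ℕ) (L : SasakiR.RSpace n → Submodule ℝ (SasakiR.RSpace n))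
    (hL : SasakiR.IsLegendrianDistribution L)
    (D : SasakiR.Connection n)
    (hD : SasakiR.IsBiLegendrianConnection L (SasakiR.conjugate L) D)
    (hg : SasakiR.IsParallel D SasakiR.metric) :
    ∀ U V W : SasakiR.RSpace n → SasakiR.RSpace n,
      SasakiR.IsSmoothField U → SasakiR.IsSmoothField V → SasakiR.IsSmoothField W →
        ∀ p, SasakiR.curvatureField D U V W p = 0 := by
  intro U V W hU hV hW p
  have hnabla (X : SasakiR.RSpace n → SasakiR.RSpace n) {Z} (hZ : SasakiR.IsSmoothField Z) :
      SasakiR.nabla D X Z = SasakiR.nabla (SasakiR.tanakaWebster n) X Z :=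
    hD.nabla_eq_tanakaWebster hL hg X hZ
  rw [← SasakiR.curvatureField_tanakaWebster hU hV hW p]
  simp only [SasakiR.curvatureField, hnabla _ hW, hnabla _ (hV.nabla_tanakaWebster hW),
    hnabla _ (hU.nabla_tanakaWebster hW)]

theorem corollary5p1 (n : ℕ) (L : SasakiR.RSpace n → Submodule ℝ (SasakiR.RSpace n))
    (hL : SasakiR.IsLegendrianFoliation L)
    (hflat : SasakiR.IsFlatFoliation L)
    (hQ : SasakiR.IsIntegrable (SasakiR.conjugate L))
    (D : SasakiR.Connection n)
    (hD : SasakiR.IsBiLegendrianConnection L (SasakiR.conjugate L) D)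
    (hg : SasakiR.IsParallel D SasakiR.metric) :
    ∀ U V W : SasakiR.RSpace n → SasakiR.RSpace n,
      SasakiR.IsSmoothField U → SasakiR.IsSmoothField V → SasakiR.IsSmoothField W →
        ∀ p, SasakiR.curvatureField D U V W p = 0 :=
  corollary5p1_general n L hL.legendrian D hD hg
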